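/- Let $\|\cdot\|$ denote the norm of $L^2(\mathbb{R})$ (complex-valued functions, Lebesgue measure), let $$\mathcal{F}[u](k)=\frac{1}{\sqrt{2\pi}}\int_{-\infty}^{\infty}u(x)e^{-ikx}\,dx$$ denote the unitary Fourier transform, extended to $L^2(\mathbb{R})$, and let $\mathbb{I}_A$ denote the indicator function of a set $A$. For an integer $N\ge 0$ and $\beta>0$ let $$\widehat{P}_N^\beta=\bigl\{e^{-\beta^2x^2/2}\,\psi(x)\;:\;\psi\text{ a polynomial of degree at most }N\bigr\}$$ (equivalently, the span of the scaled Hermite functions $\widehat{H}_n(\beta x)$, $0\le n\le N$, where $\widehat{H}_n(x)=\pi^{-1/4}(2^n n!)^{-1/2}e^{-x^2/2}H_n(x)$ and $H_n$ is the $n$-th Hermite polynomial for the weight $e^{-x^2}$), and let $\widehat{\Pi}_N^\beta$ be the $L^2$-orthogonal projection of $L^2(\mathbb{R})$ onto $\widehat{P}_N^\beta$. Theorem. Let $a=b=\frac{1}{2\sqrt2}$ and $c=\frac1{16}$. There is an absolute constant $C>0$ such that for every integer $N\ge 0$, every $\beta>0$ and every $u\in L^2(\mathbb{R})$, $$\bigl\|u-\widehat{\Pi}_N^\beta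 u\bigr\|\le C\Bigl(\bigl\|u\cdot\mathbb{I}_{\{|x|>a\sqrt N/\beta\}}\bigr\|+\bigl\|\mathcal{F}[u](k)\cdot\mathbb{I}_{\{|k|>b\sqrt N\,\beta\}}\bigr\|+\|u\|\,e^{-cN}\Bigr).$$ -/

import Mathlib

open MeasureTheory FourierTransform

noncomputable section

namespace HermiteProjection

/-- The complex Hilbert space `L²(ℝ)` for Lebesgue measure. -/
abbrev L2R : Type := Lp ℂ 2 (volume : Measure ℝ)

/-- The function `x ↦ e^{-β² x² / 2} ψ(x)` for a polynomial `ψ`. -/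
def gaussPoly (β : ℝ) (ψ : Polynomial ℂ) (x : ℝ) : ℂ :=
  (Real.exp (-(β ^ 2 * x ^ 2) / 2) : ℂ) * ψ.eval (x : ℂ)

lemma gaussPoly_add (β : ℝ) (ψ φ : Polynomial ℂ) :
    gaussPoly β (ψ + φ) = gaussPoly β ψ + gaussPoly β φ := by
  funext x
  simp [gaussPoly, mul_add]

lemma gaussPoly_smul (β : ℝ) (c : ℂ) (ψ : Polynomial ℂ) :
    gaussPoly β (c • ψ) = c • gaussPoly β ψ := by
  funext x
  simp [gaussPoly]
  ring

lemma gaussPoly_zero (β : ℝ) : gaussPoly β 0 = 0 := by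
  funext x
  simp [gaussPoly]

/-- Pairs `(f, ψ)` with `ψ` a polynomial of degree at most `N` and `f = e^{-β² x² / 2} ψ` in `L²`.
Auxiliary, for the finite-dimensionality of `scaledHermiteSpace` only. -/
def scaledHermiteGraph (N : ℕ) (β : ℝ) : Submodule ℂ (L2R × Polynomial.degreeLE ℂ N) where
  carrier := {p | (p.1 : ℝ → ℂ) =ᵐ[volume] gaussPoly β p.2}
  add_mem' := by
    rintro ⟨f, ψ⟩ ⟨g, φ⟩ hf hg
    have h : gaussPoly β ((ψ + φ : Polynomial.degreeLE ℂ N) : Polynomial ℂ)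
        = gaussPoly β ψ + gaussPoly β φ := gaussPoly_add β ψ φ
    change ((f + g : L2R) : ℝ → ℂ) =ᵐ[volume]
      gaussPoly β ((ψ + φ : Polynomial.degreeLE ℂ N) : Polynomial ℂ)
    rw [h]
    exact (Lp.coeFn_add f g).trans (Filter.EventuallyEq.add (show _ =ᵐ[volume] _ from hf) hg)
  zero_mem' := by
    change ((0 : L2R) : ℝ → ℂ) =ᵐ[volume] gaussPoly β (0 : Polynomial ℂ)
    rw [gaussPoly_zero]
    exact Lp.coeFn_zero ℂ 2 volume
  smul_mem' := by
    rintro c ⟨f, ψ⟩ hf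
    have h : gaussPoly β ((c • ψ : Polynomial.degreeLE ℂ N) : Polynomial ℂ)
        = c • gaussPoly β ψ := gaussPoly_smul β c ψ
    change ((c • f : L2R) : ℝ → ℂ) =ᵐ[volume]
      gaussPoly β ((c • ψ : Polynomial.degreeLE ℂ N) : Polynomial ℂ)
    rw [h]
    exact (Lp.coeFn_smul c f).trans
      (Filter.EventuallyEq.const_smul (show _ =ᵐ[volume] _ from hf) c)

/-- The subspace of `L²(ℝ)` of all `e^{-β² x² / 2} ψ(x)` with `ψ` a polynomial of degree at most
`N`; for `β > 0` it is the span of the scaled Hermite functions of index `0, …, N`. -/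
def scaledHermiteSpace (N : ℕ) (β : ℝ) : Submodule ℂ L2R where
  carrier := {f | ∃ ψ : Polynomial ℂ, ψ.degree ≤ (N : WithBot ℕ) ∧
    (f : ℝ → ℂ) =ᵐ[volume] gaussPoly β ψ}
  add_mem' := by
    rintro f g ⟨ψ, hψ, hf⟩ ⟨φ, hφ, hg⟩
    refine ⟨ψ + φ, (Polynomial.degree_add_le _ _).trans (max_le hψ hφ), ?_⟩
    rw [gaussPoly_add]
    exact (Lp.coeFn_add f g).trans (hf.add hg)
  zero_mem' := by
    refine ⟨0, by simp, ?_⟩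
    rw [gaussPoly_zero]
    exact Lp.coeFn_zero ℂ 2 volume
  smul_mem' := by
    rintro c f ⟨ψ, hψ, hf⟩
    refine ⟨c • ψ, (Polynomial.degree_smul_le c ψ).trans hψ, ?_⟩
    rw [gaussPoly_smul]
    exact (Lp.coeFn_smul c f).trans (hf.const_smul c)

instance (N : ℕ) (β : ℝ) : FiniteDimensional ℂ (scaledHermiteSpace N β) := by
  have h1 : FiniteDimensional ℂ (Polynomial.degreeLE ℂ (N : WithBot ℕ)) := by
    rw [← Polynomial.degreeLT_succ_eq_degreeLE]
    exact Module.Finite.equiv (Polynomial.degreeLTEquiv ℂ (N + 1)).symm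
  have h2 : FiniteDimensional ℂ (scaledHermiteGraph N β) := by
    refine FiniteDimensional.of_injective
      ((LinearMap.snd ℂ L2R (Polynomial.degreeLE ℂ (N : WithBot ℕ))).comp
        (scaledHermiteGraph N β).subtype) ?_
    rintro ⟨⟨f, ψ⟩, hf⟩ ⟨⟨g, φ⟩, hg⟩ h
    have h' : ψ = φ := h
    subst h'
    have hfg : f = g := Lp.ext (Filter.EventuallyEq.trans hf (Filter.EventuallyEq.symm hg))
    subst hfg
    rfl
  have h3 : scaledHermiteSpace N β =
      (scaledHermiteGraph N β).map (LinearMap.fst ℂ L2R _) := by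
    ext f
    constructor
    · rintro ⟨ψ, hψ, hf⟩
      exact ⟨(f, ⟨ψ, Polynomial.mem_degreeLE.2 hψ⟩), hf, rfl⟩
    · rintro ⟨⟨g, ψ⟩, hg, rfl⟩
      exact ⟨ψ, Polynomial.mem_degreeLE.1 ψ.2, hg⟩
  rw [h3]
  infer_instance

/-- The `L²`-orthogonal projection onto `scaledHermiteSpace N β`. -/
def hermiteProj (N : ℕ) (β : ℝ) : L2R →L[ℂ] L2R :=
  (scaledHermiteSpace N β).starProjection

lemma memLp_fourier_scaled (u : L2R) :
    MemLp (fun k : ℝ => ((Real.sqrt (2 * Real.pi))⁻¹ : ℂ) * (𝓕 u : L2R) ((2 * Real.pi)⁻¹ * k))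
      2 volume := by
  have hc : (2 * Real.pi)⁻¹ ≠ 0 := by positivity
  have h : MemLp ((𝓕 u : L2R) : ℝ → ℂ) 2
      (Measure.map (fun k : ℝ => (2 * Real.pi)⁻¹ * k) volume) := by
    rw [Real.map_volume_mul_left hc]
    exact (Lp.memLp _).smul_measure ENNReal.ofReal_ne_top
  exact (h.comp_of_map (by fun_prop)).const_mul _

/-- The unitary Fourier transform on `L²(ℝ)` in the angular frequency normalisation
`(2π)^{-1/2} ∫ u(x) e^{-ikx} dx`, obtained by rescaling Mathlib's Fourier transform on `L²`, which
is the continuous extension of `∫ u(x) e^{-2πiξx} dx`. -/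
def fourierL2 (u : L2R) : L2R := (memLp_fourier_scaled u).toLp _

/-- The product of `f` with the indicator function of `{x | |x| > r}`. -/
def tail (r : ℝ) (f : L2R) : L2R :=
  ((Lp.memLp f).indicator
    (measurableSet_lt measurable_const measurable_norm : MeasurableSet {x : ℝ | r < |x|})).toLp _

end HermiteProjection

end

open MeasureTheory FourierTransform

noncomputable section

namespace HermiteProjection

/-! The proof is a phase-space argument. Let `f` be the projection error. Since `f` is orthogonal to
the projection of `u`, one has `‖f‖² = |⟨f, u⟩|`. The Gabor transform with Gaussian window of
inverse width `β` is an isometry into `L²` of the phase plane, so this inner product is an integral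
over the plane. It is split at the box `|x| ≤ 2d`, `|ξ| ≤ 2d'`, where `d`, `d'` are the two cutoffs
(`ξ` in Mathlib's frequency unit); see `enorm_inner_le_gabor`.

Outside the box the transform of `u` is used. A window centred beyond `2d` sees the part of `u`
within `d` only through its Gaussian tail, hence `setLIntegral_gabor_tail_le`. Frequencies reduce to
positions by `gabor_fourier`: the Fourier transform acts as a quarter turn of the plane.

Inside the box the transform of `f` is used. Up to an explicit factor it is an entire function (in
essence the Bargmann transform) of growth `e^{|t|²}`, and orthogonality to the Hermite space means a
zero of order `N + 1` at the origin. The higher-order Schwarz lemma on a disc larger than the box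
makes it exponentially small (`norm_gabor_le_of_mem_orthogonal`), which outweighs the area of the
box, of order `N`. Dividing by `‖f‖` finishes. -/

/-! ### `L²` norms and the Fourier integral on `L¹ ∩ L²` -/

lemma eLpNorm_two_sq {α : Type*} [MeasurableSpace α] {μ : Measure α} {E : Type*}
    [NormedAddCommGroup E] (f : α → E) :
    eLpNorm f 2 μ ^ 2 = ∫⁻ x, ‖f x‖ₑ ^ 2 ∂μ := by
  have h := eLpNorm_nnreal_pow_eq_lintegral (f := f) (μ := μ) (p := 2) two_ne_zero
  rw [show ((2 : NNReal) : ℝ) = ((2 : ℕ) : ℝ) by norm_num] at h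
  simpa only [ENNReal.rpow_natCast] using! h

lemma enorm_Lp_two_sq {α : Type*} [MeasurableSpace α] {μ : Measure α} (f : Lp ℂ 2 μ) :
    ‖f‖ₑ ^ 2 = ∫⁻ x, ‖f x‖ₑ ^ 2 ∂μ := by
  rw [← eLpNorm_two_sq, Lp.enorm_def]

/-- On `L¹ ∩ L²` the `L²` Fourier transform is given by the Fourier integral. -/
lemma fourier_toLp_ae_eq {g : ℝ → ℂ} (h1 : Integrable g) (h2 : MemLp g 2) :
    ((𝓕 (h2.toLp g : L2R) : L2R) : ℝ → ℂ) =ᵐ[volume] 𝓕 g := by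
  have hcont : Continuous (𝓕 g) :=
    VectorFourier.fourierIntegral_continuous Real.continuous_fourierChar
      (by exact (innerSL ℝ).continuous₂) h1
  refine ae_eq_of_integral_contDiff_smul_eq
    ((Lp.memLp _).locallyIntegrable (by norm_num)) hcont.locallyIntegrable ?_
  intro φ hφ hφc
  have hc : HasCompactSupport (Complex.ofRealCLM ∘ φ) := hφc.comp_left rfl
  have hd : ContDiff ℝ (⊤ : ℕ∞) (Complex.ofRealCLM ∘ φ) := Complex.ofRealCLM.contDiff.comp hφ
  set s : SchwartzMap ℝ ℂ := hc.toSchwartzMap hd with hs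
  have hsx : ∀ x, s x = (φ x : ℂ) := fun x => rfl
  -- The Fourier integral is symmetric for the bilinear pairing, and the distributional transform is
  -- defined by the same symmetry. Both candidates thus agree on test functions.
  have hfl : ∫ ξ, 𝓕 (s : ℝ → ℂ) ξ • g ξ = ∫ x, s x • 𝓕 g x := by
    simpa using! VectorFourier.integral_fourierIntegral_smul_eq_flip (L := innerₗ ℝ)
      Real.continuous_fourierChar continuous_inner s.integrable h1
  calc ∫ x, φ x • (𝓕 (h2.toLp g : L2R) : L2R) x
      = ((𝓕 (h2.toLp g : L2R) : L2R) : TemperedDistribution ℝ ℂ) s := by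
        simp [hsx]
    _ = ∫ x, (𝓕 s : SchwartzMap ℝ ℂ) x • (h2.toLp g : L2R) x := by
        rw [← Lp.fourier_toTemperedDistribution_eq]
        simp
    _ = ∫ x, 𝓕 (s : ℝ → ℂ) x • g x := by
        apply integral_congr_ae
        filter_upwards [h2.coeFn_toLp] with x hx
        rw [hx, SchwartzMap.fourier_coe]
    _ = ∫ x, φ x • 𝓕 g x := by
        rw [hfl]; simp [hsx]

lemma lintegral_enorm_fourier_sq {g : ℝ → ℂ} (h1 : Integrable g) (h2 : MemLp g 2) :
    ∫⁻ ξ, ‖𝓕 g ξ‖ₑ ^ 2 = ∫⁻ y, ‖g y‖ₑ ^ 2 := by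
  calc ∫⁻ ξ, ‖𝓕 g ξ‖ₑ ^ 2 = ∫⁻ ξ, ‖(𝓕 (h2.toLp g : L2R) : L2R) ξ‖ₑ ^ 2 := by
        apply lintegral_congr_ae
        filter_upwards [fourier_toLp_ae_eq h1 h2] with ξ hξ
        rw [hξ]
    _ = ‖(h2.toLp g : L2R)‖ₑ ^ 2 := by
        rw [← enorm_Lp_two_sq, ← ofReal_norm, Lp.norm_fourier_eq, ofReal_norm]
    _ = ∫⁻ y, ‖g y‖ₑ ^ 2 := by
        rw [Lp.enorm_toLp, eLpNorm_two_sq]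

lemma integral_mul_eq_inner {a b : ℝ → ℂ} (ha : MemLp a 2) (hb : MemLp b 2) :
    ∫ y, a y * b y = inner ℂ (ha.star.toLp (star a) : L2R) (hb.toLp b : L2R) := by
  rw [L2.inner_def]
  apply integral_congr_ae
  filter_upwards [ha.star.coeFn_toLp, hb.coeFn_toLp] with y h1 h2
  simp [h1, h2, mul_comm]

lemma norm_integral_mul_le {a b : ℝ → ℂ} (ha : MemLp a 2) (hb : MemLp b 2) :
    ‖∫ y, a y * b y‖ ≤ (eLpNorm a 2).toReal * (eLpNorm b 2).toReal := by
  rw [integral_mul_eq_inner ha hb]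
  refine (norm_inner_le_norm _ _).trans ?_
  rw [Lp.norm_toLp, Lp.norm_toLp, eLpNorm_star]

/-! ### The normalised Gaussian and its tails -/

/-- The `L²`-normalised Gaussian of inverse width `β`. -/
def gauss (β s : ℝ) : ℝ := Real.sqrt (β / Real.sqrt Real.pi) * Real.exp (-(β ^ 2 * s ^ 2) / 2)

@[fun_prop]
lemma continuous_gauss (β : ℝ) : Continuous (gauss β) := by
  unfold gauss; fun_prop

lemma gauss_nonneg (β s : ℝ) : 0 ≤ gauss β s := by unfold gauss; positivity

lemma gauss_sq {β : ℝ} (hβ : 0 < β) (s : ℝ) :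
    gauss β s ^ 2 = β / Real.sqrt Real.pi * Real.exp (-β ^ 2 * s ^ 2) := by
  rw [gauss, mul_pow, Real.sq_sqrt (by positivity), ← Real.exp_nat_mul]
  congr 2
  push_cast; ring

lemma gauss_le {β : ℝ} (s : ℝ) : gauss β s ≤ Real.sqrt (β / Real.sqrt Real.pi) := by
  unfold gauss
  refine mul_le_of_le_one_right (by positivity) (Real.exp_le_one_iff.2 ?_)
  have := sq_nonneg (β * s)
  nlinarith

lemma integral_gauss_sq {β : ℝ} (hβ : 0 < β) : ∫ s, gauss β s ^ 2 = 1 := by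
  simp_rw [gauss_sq hβ]
  rw [integral_const_mul, integral_gaussian, Real.sqrt_div (by positivity),
    Real.sqrt_sq hβ.le]
  have := Real.sqrt_pos.2 Real.pi_pos
  field_simp

lemma enorm_gauss_sq (β s : ℝ) :
    ‖(gauss β s : ℂ)‖ₑ ^ 2 = ENNReal.ofReal (gauss β s ^ 2) := by
  rw [← ofReal_norm, Complex.norm_real, Real.norm_of_nonneg (gauss_nonneg β s),
    ENNReal.ofReal_pow (gauss_nonneg β s)]

lemma lintegral_gauss_sq {β : ℝ} (hβ : 0 < β) : ∫⁻ s, ‖(gauss β s : ℂ)‖ₑ ^ 2 = 1 := by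
  simp_rw [enorm_gauss_sq]
  rw [← ofReal_integral_eq_lintegral_ofReal _ (Filter.Eventually.of_forall fun s => sq_nonneg _),
    integral_gauss_sq hβ, ENNReal.ofReal_one]
  simp_rw [gauss_sq hβ]
  exact (integrable_exp_neg_mul_sq (by positivity)).const_mul _

lemma eLpNorm_gauss_sub {β : ℝ} (hβ : 0 < β) (x : ℝ) :
    eLpNorm (fun y : ℝ => (gauss β (y - x) : ℂ)) 2 volume = 1 := by
  have h : eLpNorm (fun y : ℝ => (gauss β (y - x) : ℂ)) 2 volume ^ 2 = 1 := by
    rw [eLpNorm_two_sq, lintegral_sub_right_eq_self (fun s => ‖(gauss β s : ℂ)‖ₑ ^ 2) x,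
      lintegral_gauss_sq hβ]
  exact (ENNReal.pow_right_strictMono two_ne_zero).injective (by simpa using h)

lemma memLp_gauss_sub {β : ℝ} (hβ : 0 < β) (x : ℝ) :
    MemLp (fun y : ℝ => (gauss β (y - x) : ℂ)) 2 volume :=
  ⟨by fun_prop, by simp [eLpNorm_gauss_sub hβ]⟩

/-- For `|s| ≥ d` one has `s² ≥ d² + (|s| - d)²`. Keeping both translates covers both signs of `s`,
and each has integral one. -/
lemma gauss_sq_le_of_le_abs {β s d : ℝ} (hβ : 0 < β) (hd : 0 ≤ d) (hs : d ≤ |s|) :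
    gauss β s ^ 2 ≤ Real.exp (-β ^ 2 * d ^ 2) * (gauss β (s - d) ^ 2 + gauss β (s + d) ^ 2) := by
  have key : ∀ t : ℝ, d ^ 2 + t ^ 2 ≤ s ^ 2 →
      gauss β s ^ 2 ≤ Real.exp (-β ^ 2 * d ^ 2) * gauss β t ^ 2 := by
    intro t ht
    rw [gauss_sq hβ, gauss_sq hβ, mul_left_comm, ← Real.exp_add]
    gcongr
    nlinarith [sq_nonneg β]
  have hp := (Real.exp_pos (-β ^ 2 * d ^ 2)).le
  rw [mul_add]
  rcases le_abs.1 hs with h | h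
  · have := key (s - d) (by nlinarith)
    nlinarith [mul_nonneg hp (sq_nonneg (gauss β (s + d)))]
  · have := key (s + d) (by nlinarith)
    nlinarith [mul_nonneg hp (sq_nonneg (gauss β (s - d)))]

lemma lintegral_gauss_sub_left {β : ℝ} (hβ : 0 < β) (y : ℝ) :
    ∫⁻ x, ‖(gauss β (y - x) : ℂ)‖ₑ ^ 2 = 1 := by
  rw [lintegral_sub_left_eq_self (fun s => ‖(gauss β s : ℂ)‖ₑ ^ 2) y, lintegral_gauss_sq hβ]

/-- Gaussian tail estimate around a centre `y` with `|y| ≤ d`. -/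
lemma setLIntegral_gauss_sub_le {β d y : ℝ} (hβ : 0 < β) (hd : 0 ≤ d) (hy : |y| ≤ d) :
    ∫⁻ x in {x : ℝ | 2 * d < |x|}, ‖(gauss β (y - x) : ℂ)‖ₑ ^ 2 ≤
      2 * ENNReal.ofReal (Real.exp (-β ^ 2 * d ^ 2)) := by
  have hS : MeasurableSet {x : ℝ | 2 * d < |x|} := measurableSet_lt (by fun_prop) (by fun_prop)
  calc ∫⁻ x in {x : ℝ | 2 * d < |x|}, ‖(gauss β (y - x) : ℂ)‖ₑ ^ 2
      ≤ ∫⁻ x in {x : ℝ | 2 * d < |x|}, ENNReal.ofReal (Real.exp (-β ^ 2 * d ^ 2)) *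
        (‖(gauss β (y - d - x) : ℂ)‖ₑ ^ 2 + ‖(gauss β (y + d - x) : ℂ)‖ₑ ^ 2) := by
        refine setLIntegral_mono' hS fun x hx => ?_
        have h1 : d ≤ |y - x| := by
          have := abs_sub_abs_le_abs_sub x y
          rw [abs_sub_comm x y] at this
          have hx' : 2 * d < |x| := hx
          linarith
        rw [enorm_gauss_sq, enorm_gauss_sq, enorm_gauss_sq,
          ← ENNReal.ofReal_add (sq_nonneg _) (sq_nonneg _),
          ← ENNReal.ofReal_mul (Real.exp_pos _).le]
        apply ENNReal.ofReal_le_ofReal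
        have := gauss_sq_le_of_le_abs hβ hd h1
        rwa [sub_right_comm, sub_add_eq_add_sub] at this
    _ ≤ ∫⁻ x, ENNReal.ofReal (Real.exp (-β ^ 2 * d ^ 2)) *
        (‖(gauss β (y - d - x) : ℂ)‖ₑ ^ 2 + ‖(gauss β (y + d - x) : ℂ)‖ₑ ^ 2) :=
        setLIntegral_le_lintegral _ _
    _ = 2 * ENNReal.ofReal (Real.exp (-β ^ 2 * d ^ 2)) := by
        rw [lintegral_const_mul _ (by fun_prop), lintegral_add_left (by fun_prop),
          lintegral_gauss_sub_left hβ, lintegral_gauss_sub_left hβ, one_add_one_eq_two, mul_comm]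

/-! ### The Gabor transform as an isometry -/

/-- The Gabor transform: the inner product of `u` with the Gaussian of inverse width `β`
centred at position `x` and frequency `ξ`. -/
def gabor (β : ℝ) (u : L2R) (x ξ : ℝ) : ℂ :=
  ∫ y, Complex.exp (↑(-2 * Real.pi * y * ξ) * Complex.I) * ((gauss β (y - x) : ℂ) * u y)

lemma gabor_eq_fourier (β : ℝ) (u : L2R) (x ξ : ℝ) :
    gabor β u x ξ = 𝓕 (fun y => (gauss β (y - x) : ℂ) * u y) ξ := by
  rw [Real.fourier_real_eq_integral_exp_smul]; rfl

lemma integrable_gauss_mul {β : ℝ} (hβ : 0 < β) (u : L2R) (x : ℝ) :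
    Integrable (fun y => (gauss β (y - x) : ℂ) * u y) :=
  (memLp_gauss_sub hβ x).integrable_mul (Lp.memLp u)

lemma memLp_gauss_mul (β : ℝ) (u : L2R) (x : ℝ) :
    MemLp (fun y => (gauss β (y - x) : ℂ) * u y) 2 := by
  refine (Lp.memLp u).of_le_mul (c := Real.sqrt (β / Real.sqrt Real.pi))
    ((by fun_prop : Continuous fun y => (gauss β (y - x) : ℂ)).aestronglyMeasurable.mul
      (Lp.aestronglyMeasurable u)) (Filter.Eventually.of_forall fun y => ?_)
  rw [norm_mul, Complex.norm_real, Real.norm_of_nonneg (gauss_nonneg _ _)]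
  gcongr
  exact gauss_le _

lemma lintegral_gabor_sq {β : ℝ} (hβ : 0 < β) (u : L2R) (x : ℝ) :
    ∫⁻ ξ, ‖gabor β u x ξ‖ₑ ^ 2 = ∫⁻ y, ‖u y‖ₑ ^ 2 * ‖(gauss β (y - x) : ℂ)‖ₑ ^ 2 := by
  simp_rw [gabor_eq_fourier]
  rw [lintegral_enorm_fourier_sq (integrable_gauss_mul hβ u x) (memLp_gauss_mul β u x)]
  simp_rw [enorm_mul, mul_pow, mul_comm]

/-- Plancherel in the frequency, then Tonelli. `S = univ` gives the isometry, and `S = {2d < |x|}`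
the tail estimate. -/
lemma setLIntegral_gabor_sq {β : ℝ} (hβ : 0 < β) (u : L2R) (S : Set ℝ) :
    ∫⁻ x in S, ∫⁻ ξ, ‖gabor β u x ξ‖ₑ ^ 2 =
      ∫⁻ y, ‖u y‖ₑ ^ 2 * ∫⁻ x in S, ‖(gauss β (y - x) : ℂ)‖ₑ ^ 2 := by
  have hu := (Lp.stronglyMeasurable u).measurable
  simp_rw [lintegral_gabor_sq hβ]
  rw [lintegral_lintegral_swap]
  · refine lintegral_congr fun y => ?_
    rw [lintegral_const_mul _ (by fun_prop)]
  · apply Measurable.aemeasurable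
    simp only [Function.uncurry_def]
    fun_prop

lemma stronglyMeasurable_gabor (β : ℝ) (u : L2R) :
    StronglyMeasurable (fun p : ℝ × ℝ => gabor β u p.1 p.2) := by
  have hu := (Lp.stronglyMeasurable u).measurable
  unfold gabor
  apply StronglyMeasurable.integral_prod_right
  apply Measurable.stronglyMeasurable
  simp only [Function.uncurry_def]
  fun_prop

lemma lintegral_gabor_prod {β : ℝ} (hβ : 0 < β) (u : L2R) :
    ∫⁻ p : ℝ × ℝ, ‖gabor β u p.1 p.2‖ₑ ^ 2 = ‖u‖ₑ ^ 2 := by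
  have hm := (stronglyMeasurable_gabor β u).measurable
  rw [Measure.volume_eq_prod, lintegral_prod _ (by fun_prop)]
  rw [← setLIntegral_univ, setLIntegral_gabor_sq hβ]
  simp_rw [setLIntegral_univ, lintegral_gauss_sub_left hβ, mul_one]
  rw [enorm_Lp_two_sq]

lemma eLpNorm_gabor {β : ℝ} (hβ : 0 < β) (u : L2R) :
    eLpNorm (fun p : ℝ × ℝ => gabor β u p.1 p.2) 2 volume = ‖u‖ₑ := by
  have h := lintegral_gabor_prod hβ u
  rw [← eLpNorm_two_sq (fun p : ℝ × ℝ => gabor β u p.1 p.2)] at h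
  exact (ENNReal.pow_right_strictMono two_ne_zero).injective h

lemma memLp_gabor {β : ℝ} (hβ : 0 < β) (u : L2R) :
    MemLp (fun p : ℝ × ℝ => gabor β u p.1 p.2) 2 volume :=
  ⟨(stronglyMeasurable_gabor β u).aestronglyMeasurable, by rw [eLpNorm_gabor hβ]; simp⟩

lemma gabor_add {β : ℝ} (hβ : 0 < β) (u v : L2R) (x ξ : ℝ) :
    gabor β (u + v) x ξ = gabor β u x ξ + gabor β v x ξ := by
  have hi : ∀ w : L2R, Integrable (fun y =>
      Complex.exp (↑(-2 * Real.pi * y * ξ) * Complex.I) * ((gauss β (y - x) : ℂ) * w y)) :=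
    fun w => (integrable_gauss_mul hβ w x).bdd_mul (c := 1)
      (Continuous.aestronglyMeasurable (by fun_prop))
      (Filter.Eventually.of_forall fun y => (Complex.norm_exp_ofReal_mul_I _).le)
  rw [gabor, gabor, gabor, ← integral_add (hi u) (hi v)]
  apply integral_congr_ae
  filter_upwards [Lp.coeFn_add u v] with y hy
  rw [hy, Pi.add_apply]; ring

lemma gabor_smul (β : ℝ) (c : ℂ) (u : L2R) (x ξ : ℝ) :
    gabor β (c • u) x ξ = c * gabor β u x ξ := by
  rw [gabor, gabor, ← integral_const_mul]
  apply integral_congr_ae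
  filter_upwards [Lp.coeFn_smul c u] with y hy
  rw [hy, Pi.smul_apply, smul_eq_mul]; ring

/-- The Gabor transform as a linear isometry into `L²` of the phase plane. -/
def gaborIsometry {β : ℝ} (hβ : 0 < β) : L2R →ₗᵢ[ℂ] Lp ℂ 2 (volume : Measure (ℝ × ℝ)) where
  toFun u := (memLp_gabor hβ u).toLp _
  map_add' u v := by
    rw [← MemLp.toLp_add]
    congr 1
    funext p
    exact gabor_add hβ u v p.1 p.2
  map_smul' c u := by
    rw [RingHom.id_apply, ← MemLp.toLp_const_smul]
    congr 1
    funext p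
    exact gabor_smul β c u p.1 p.2
  norm_map' u := by
    change ‖(memLp_gabor hβ u).toLp _‖ = ‖u‖
    rw [Lp.norm_toLp, eLpNorm_gabor hβ, toReal_enorm]

lemma integral_gabor_inner {β : ℝ} (hβ : 0 < β) (f u : L2R) :
    ∫ p : ℝ × ℝ, inner ℂ (gabor β f p.1 p.2) (gabor β u p.1 p.2) = inner ℂ f u := by
  rw [← (gaborIsometry hβ).inner_map_map f u, L2.inner_def]
  apply integral_congr_ae
  filter_upwards [(memLp_gabor hβ f).coeFn_toLp, (memLp_gabor hβ u).coeFn_toLp] with p h1 h2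
  change _ = inner ℂ ((memLp_gabor hβ f).toLp _ p) ((memLp_gabor hβ u).toLp _ p)
  rw [h1, h2]

/-- The part of the Gabor transform over positions beyond `2d` is controlled by the part of the
function beyond `d`, up to a Gaussian error. -/
lemma setLIntegral_gabor_tail_le {β d : ℝ} (hβ : 0 < β) (hd : 0 ≤ d) (u : L2R) :
    ∫⁻ x in {x : ℝ | 2 * d < |x|}, ∫⁻ ξ, ‖gabor β u x ξ‖ₑ ^ 2 ≤
      (∫⁻ y in {y : ℝ | d < |y|}, ‖u y‖ₑ ^ 2) +
        2 * ENNReal.ofReal (Real.exp (-β ^ 2 * d ^ 2)) * ‖u‖ₑ ^ 2 := by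
  have hu := (Lp.stronglyMeasurable u).measurable
  have hS : MeasurableSet {y : ℝ | d < |y|} := measurableSet_lt (by fun_prop) (by fun_prop)
  rw [setLIntegral_gabor_sq hβ, ← lintegral_indicator hS, enorm_Lp_two_sq,
    ← lintegral_const_mul _ (by fun_prop),
    ← lintegral_add_left (Measurable.indicator (by fun_prop) hS)]
  refine lintegral_mono fun y => ?_
  -- Beyond `d` the window integral is at most its total mass one; within `d` only the Gaussian tail
  -- is left.
  by_cases hy : d < |y|
  · rw [Set.indicator_of_mem (by exact hy)]
    refine le_add_right (mul_le_of_le_one_right' ?_)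
    exact (setLIntegral_le_lintegral _ _).trans (lintegral_gauss_sub_left hβ y).le
  · rw [Set.indicator_of_notMem (by exact hy), zero_add, mul_comm]
    gcongr
    exact setLIntegral_gauss_sub_le hβ hd (not_lt.1 hy)

/-! ### Wave packets and the quarter turn of the phase plane -/

/-- The Gaussian wave packet of inverse width `β` at position `x` and frequency `ξ`. -/
def wavePacket (β x ξ y : ℝ) : ℂ :=
  Complex.exp (↑(2 * Real.pi * y * ξ) * Complex.I) * (gauss β (y - x) : ℂ)

@[fun_prop]
lemma continuous_wavePacket (β x ξ : ℝ) : Continuous (wavePacket β x ξ) := by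
  unfold wavePacket; fun_prop

lemma norm_wavePacket (β x ξ y : ℝ) :
    ‖wavePacket β x ξ y‖ = ‖(gauss β (y - x) : ℂ)‖ := by
  rw [wavePacket, norm_mul, Complex.norm_exp_ofReal_mul_I, one_mul]

lemma memLp_wavePacket {β : ℝ} (hβ : 0 < β) (x ξ : ℝ) : MemLp (wavePacket β x ξ) 2 :=
  (memLp_gauss_sub hβ x).of_le (by fun_prop)
    (Filter.Eventually.of_forall fun y => (norm_wavePacket β x ξ y).le)

lemma ofReal_gauss (β s : ℝ) :
    (gauss β s : ℂ) = (Real.sqrt (β / Real.sqrt Real.pi) : ℂ) *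
      Complex.exp (-(β ^ 2 * s ^ 2) / 2) := by
  rw [gauss]; push_cast; rfl

lemma wavePacket_eq_cexp (β x ξ y : ℝ) :
    wavePacket β x ξ y = (Real.sqrt (β / Real.sqrt Real.pi) : ℂ) *
      Complex.exp (-(β ^ 2 / 2) * y ^ 2 + (β ^ 2 * x + 2 * Real.pi * ξ * Complex.I) * y
        + -(β ^ 2 * x ^ 2 / 2)) := by
  rw [wavePacket, ofReal_gauss, mul_left_comm, ← Complex.exp_add]
  congr 2
  push_cast; ring

lemma integrable_wavePacket {β : ℝ} (hβ : 0 < β) (x ξ : ℝ) : Integrable (wavePacket β x ξ) := by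
  have h : (-((β : ℂ) ^ 2 / 2)).re < 0 := by
    rw [show -((β : ℂ) ^ 2 / 2) = ((-(β ^ 2 / 2) : ℝ) : ℂ) by push_cast; ring, Complex.ofReal_re]
    have : 0 < β ^ 2 := by positivity
    linarith
  rw [funext (wavePacket_eq_cexp β x ξ)]
  exact (integrable_cexp_quadratic' h _ _).const_mul _

lemma fourier_wavePacket {β : ℝ} (hβ : 0 < β) (x ξ η : ℝ) :
    𝓕 (wavePacket β x ξ) η = Complex.exp (↑(2 * Real.pi * x * (ξ - η)) * Complex.I) *
      (gauss (2 * Real.pi / β) (η - ξ) : ℂ) := by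
  have h : (-((β : ℂ) ^ 2 / 2)).re < 0 := by
    rw [show -((β : ℂ) ^ 2 / 2) = ((-(β ^ 2 / 2) : ℝ) : ℂ) by push_cast; ring, Complex.ofReal_re]
    have : 0 < β ^ 2 := by positivity
    linarith
  have hβ0 : (β : ℂ) ≠ 0 := by exact_mod_cast hβ.ne'
  have hπ : (Real.pi : ℂ) ≠ 0 := by exact_mod_cast Real.pi_ne_zero
  rw [Real.fourier_real_eq_integral_exp_smul]
  have hint : ∀ y : ℝ, Complex.exp (↑(-2 * Real.pi * y * η) * Complex.I) • wavePacket β x ξ y =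
      (Real.sqrt (β / Real.sqrt Real.pi) : ℂ) *
      Complex.exp (-(β ^ 2 / 2) * y ^ 2 + (β ^ 2 * x + 2 * Real.pi * (ξ - η) * Complex.I) * y
        + -(β ^ 2 * x ^ 2 / 2)) := by
    intro y
    rw [wavePacket_eq_cexp, smul_eq_mul, mul_left_comm, ← Complex.exp_add]
    congr 2
    push_cast; ring
  simp_rw [hint]
  rw [integral_const_mul, integral_cexp_quadratic h, ofReal_gauss,
    mul_left_comm (Complex.exp _), ← Complex.exp_add, ← mul_assoc]
  congr 1
  · rw [show (Real.pi : ℂ) / - -((β : ℂ) ^ 2 / 2) = ((2 * Real.pi / β ^ 2 : ℝ) : ℂ) by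
        push_cast; rw [neg_neg]; field_simp,
      show (1 / 2 : ℂ) = ((1 / 2 : ℝ) : ℂ) by push_cast; ring,
      ← Complex.ofReal_cpow (by positivity), ← Real.sqrt_eq_rpow, ← Complex.ofReal_mul,
      ← Real.sqrt_mul (by positivity)]
    congr 2
    field_simp
  · congr 1
    push_cast
    field_simp
    ring_nf
    rw [Complex.I_sq]
    ring

lemma gabor_eq_inner {β : ℝ} (hβ : 0 < β) (u : L2R) (x ξ : ℝ) :
    gabor β u x ξ = inner ℂ ((memLp_wavePacket hβ x ξ).toLp _ : L2R) u := by
  rw [L2.inner_def, gabor]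
  apply integral_congr_ae
  filter_upwards [(memLp_wavePacket hβ x ξ).coeFn_toLp] with y hy
  rw [hy, RCLike.inner_apply, wavePacket, map_mul, ← Complex.exp_conj, map_mul, Complex.conj_I,
    Complex.conj_ofReal, Complex.conj_ofReal]
  rw [show (↑(-2 * Real.pi * y * ξ) : ℂ) * Complex.I = ↑(2 * Real.pi * y * ξ) * -Complex.I by
    push_cast; ring]
  ring

/-- The Gabor transforms of `u` and of its Fourier transform agree up to a rotation of the phase
plane by a quarter turn and a phase factor. -/
lemma gabor_fourier {β : ℝ} (hβ : 0 < β) (u : L2R) (x ξ : ℝ) :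
    gabor β u x ξ = Complex.exp (↑(-2 * Real.pi * x * ξ) * Complex.I) *
      gabor (2 * Real.pi / β) (𝓕 u) ξ (-x) := by
  -- Parseval: the transform of a wave packet is again a wave packet, of inverse width `2π/β`.
  rw [gabor_eq_inner hβ, ← Lp.inner_fourier_eq, L2.inner_def, gabor, ← integral_const_mul]
  apply integral_congr_ae
  filter_upwards [fourier_toLp_ae_eq (integrable_wavePacket hβ x ξ) (memLp_wavePacket hβ x ξ)]
    with η hη
  rw [hη, fourier_wavePacket hβ, RCLike.inner_apply, map_mul, ← Complex.exp_conj, map_mul,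
    Complex.conj_I, Complex.conj_ofReal, Complex.conj_ofReal, ← mul_assoc (Complex.exp _),
    ← Complex.exp_add, mul_comm (_ : ℂ) (_ * _), mul_assoc]
  congr 2
  push_cast; ring

lemma enorm_gabor_fourier {β : ℝ} (hβ : 0 < β) (u : L2R) (x ξ : ℝ) :
    ‖gabor β u x ξ‖ₑ = ‖gabor (2 * Real.pi / β) (𝓕 u) ξ (-x)‖ₑ := by
  rw [gabor_fourier hβ, enorm_mul, ← ofReal_norm (Complex.exp _), Complex.norm_exp_ofReal_mul_I]
  simp

/-! ### Exponential and polynomial weights against the Gaussian -/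

lemma exp_mul_gauss {β : ℝ} (hβ : 0 < β) (τ y : ℝ) :
    Real.exp (τ * y) * gauss β y = Real.exp (τ ^ 2 / (2 * β ^ 2)) * gauss β (y - τ / β ^ 2) := by
  rw [gauss, gauss, mul_left_comm, mul_left_comm (Real.exp (τ ^ 2 / _)), ← Real.exp_add,
    ← Real.exp_add]
  congr 2
  field_simp
  ring

lemma norm_cexp_mul_gauss {β : ℝ} (hβ : 0 < β) (z : ℂ) (y : ℝ) :
    ‖Complex.exp (z * y) * (gauss β y : ℂ)‖ =
      ‖((Real.exp (z.re ^ 2 / (2 * β ^ 2)) : ℝ) : ℂ) * (gauss β (y - z.re / β ^ 2) : ℂ)‖ := by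
  rw [norm_mul, Complex.norm_exp, Complex.re_mul_ofReal, ← Complex.ofReal_mul,
    ← exp_mul_gauss hβ, Complex.norm_real, Complex.norm_real, norm_mul,
    Real.norm_of_nonneg (Real.exp_pos _).le]

lemma memLp_cexp_mul_gauss {β : ℝ} (hβ : 0 < β) (z : ℂ) :
    MemLp (fun y : ℝ => Complex.exp (z * y) * (gauss β y : ℂ)) 2 :=
  ((memLp_gauss_sub hβ _).const_mul _).of_le (by fun_prop)
    (Filter.Eventually.of_forall fun y => (norm_cexp_mul_gauss hβ z y).le)

lemma eLpNorm_cexp_mul_gauss {β : ℝ} (hβ : 0 < β) (z : ℂ) :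
    (eLpNorm (fun y : ℝ => Complex.exp (z * y) * (gauss β y : ℂ)) 2 volume).toReal =
      Real.exp (z.re ^ 2 / (2 * β ^ 2)) := by
  rw [eLpNorm_congr_norm_ae (Filter.Eventually.of_forall fun y => norm_cexp_mul_gauss hβ z y)]
  have := eLpNorm_const_smul ((Real.exp (z.re ^ 2 / (2 * β ^ 2)) : ℝ) : ℂ)
    (fun y : ℝ => (gauss β (y - z.re / β ^ 2) : ℂ)) 2 volume
  simp only [Pi.smul_def, smul_eq_mul] at this
  rw [this, eLpNorm_gauss_sub hβ, mul_one, toReal_enorm, Complex.norm_real,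
    Real.norm_of_nonneg (Real.exp_pos _).le]

lemma memLp_exp_abs_mul_gauss {β : ℝ} (hβ : 0 < β) (R : ℝ) :
    MemLp (fun y : ℝ => Real.exp (R * |y|) * gauss β y) 2 := by
  have h : ∀ τ : ℝ, MemLp (fun y : ℝ => Real.exp (τ * y) * gauss β y) 2 := fun τ => by
    refine (memLp_cexp_mul_gauss hβ τ).of_le (by fun_prop)
      (Filter.Eventually.of_forall fun y => ?_)
    rw [norm_mul, norm_mul, ← Complex.ofReal_mul, ← Complex.ofReal_exp, Complex.norm_real,
      Complex.norm_real]
  refine ((h R).add (h (-R))).of_le (by fun_prop) (Filter.Eventually.of_forall fun y => ?_)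
  have hg := gauss_nonneg β y
  rw [Pi.add_apply, Real.norm_of_nonneg (by positivity), Real.norm_of_nonneg (by positivity),
    ← add_mul]
  gcongr
  rcases abs_cases y with ⟨h, -⟩ | ⟨h, -⟩ <;> rw [h]
  · linarith [Real.exp_pos (-R * y)]
  · rw [mul_neg, ← neg_mul]; linarith [Real.exp_pos (R * y)]

/-- A single term of the exponential series bounds the power, so a polynomial weight costs one unit
of exponential rate. -/
lemma pow_abs_mul_exp_le (n : ℕ) (R y : ℝ) :
    |y| ^ n * Real.exp (R * |y|) ≤ n.factorial * Real.exp ((R + 1) * |y|) := by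
  have h := Real.pow_div_factorial_le_exp |y| (abs_nonneg y) n
  rw [div_le_iff₀ (by positivity), mul_comm] at h
  rw [add_mul, Real.exp_add, one_mul, mul_comm (Real.exp _) (Real.exp _), ← mul_assoc]
  gcongr

lemma memLp_pow_mul_exp_mul_gauss {β : ℝ} (hβ : 0 < β) (n : ℕ) (R : ℝ) :
    MemLp (fun y : ℝ => |y| ^ n * Real.exp (R * |y|) * gauss β y) 2 := by
  refine ((memLp_exp_abs_mul_gauss hβ (R + 1)).const_mul (n.factorial : ℝ)).of_le (by fun_prop)
    (Filter.Eventually.of_forall fun y => ?_)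
  have hg := gauss_nonneg β y
  rw [Real.norm_of_nonneg (by positivity), Real.norm_of_nonneg (by positivity), ← mul_assoc]
  exact mul_le_mul_of_nonneg_right (pow_abs_mul_exp_le n R y) hg

lemma integrable_pow_mul_exp_mul_gauss_mul {β : ℝ} (hβ : 0 < β) (f : L2R) (n : ℕ) (R : ℝ) :
    Integrable (fun y : ℝ => |y| ^ n * Real.exp (R * |y|) * gauss β y * ‖f y‖) :=
  (memLp_pow_mul_exp_mul_gauss hβ n R).integrable_mul (Lp.memLp f).norm

/-! ### The Gaussian Laplace transform and its zero at the origin -/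

/-- The Laplace transform of `f` times a Gaussian. -/
def gaussLaplace (β : ℝ) (f : L2R) (z : ℂ) : ℂ :=
  ∫ y : ℝ, Complex.exp (z * y) * (gauss β y : ℂ) * f y

/-- Cauchy–Schwarz; completing the square turns the weighted Gaussian into a translate with an
explicit factor. -/
lemma norm_gaussLaplace_le {β : ℝ} (hβ : 0 < β) (f : L2R) (z : ℂ) :
    ‖gaussLaplace β f z‖ ≤ Real.exp (z.re ^ 2 / (2 * β ^ 2)) * ‖f‖ := by
  refine (norm_integral_mul_le (memLp_cexp_mul_gauss hβ z) (Lp.memLp f)).trans ?_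
  rw [eLpNorm_cexp_mul_gauss hβ, ← Lp.norm_def]

lemma norm_cexp_mul_ofReal_le {z : ℂ} {R : ℝ} (hz : ‖z‖ ≤ R) (y : ℝ) :
    ‖Complex.exp (z * y)‖ ≤ Real.exp (R * |y|) := by
  refine (Complex.norm_exp_le_exp_norm _).trans (Real.exp_le_exp.2 ?_)
  rw [norm_mul, Complex.norm_real, Real.norm_eq_abs]
  gcongr

lemma differentiable_gaussLaplace {β : ℝ} (hβ : 0 < β) (f : L2R) :
    Differentiable ℂ (gaussLaplace β f) := by
  intro z₀
  have hf := Lp.aestronglyMeasurable f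
  refine (hasDerivAt_integral_of_dominated_loc_of_deriv_le
    (F' := fun z y => (y : ℂ) * Complex.exp (z * y) * (gauss β y : ℂ) * f y)
    (bound := fun y => |y| ^ 1 * Real.exp ((‖z₀‖ + 1) * |y|) * gauss β y * ‖f y‖)
    (Metric.ball_mem_nhds z₀ one_pos) ?_ ?_ ?_ ?_ ?_ ?_).2.differentiableAt
  · exact Filter.Eventually.of_forall fun z =>
      (Continuous.aestronglyMeasurable (by fun_prop)).mul hf
  · exact (memLp_cexp_mul_gauss hβ z₀).integrable_mul (Lp.memLp f)
  · exact (Continuous.aestronglyMeasurable (by fun_prop)).mul hf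
  · refine Filter.Eventually.of_forall fun y z hz => ?_
    have hz' : ‖z‖ ≤ ‖z₀‖ + 1 := by
      have h1 := norm_sub_norm_le z z₀
      have h2 := mem_ball_iff_norm.1 hz
      linarith
    have hg := gauss_nonneg β y
    rw [norm_mul, norm_mul, norm_mul, Complex.norm_real, Complex.norm_real,
      Real.norm_of_nonneg hg, pow_one, Real.norm_eq_abs]
    gcongr
    exact norm_cexp_mul_ofReal_le hz' y
  · exact integrable_pow_mul_exp_mul_gauss_mul hβ f 1 _
  · refine Filter.Eventually.of_forall fun y z _ => ?_
    have h := ((hasDerivAt_id z).mul_const (y : ℂ)).cexp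
    simp only [id, one_mul] at h
    rw [mul_comm (y : ℂ)]
    exact (h.mul_const _).mul_const _

lemma memLp_gaussPoly_X_pow {β : ℝ} (hβ : 0 < β) (n : ℕ) :
    MemLp (gaussPoly β (Polynomial.X ^ n)) 2 := by
  have hc : 0 < Real.sqrt (β / Real.sqrt Real.pi) := by
    have := Real.sqrt_pos.2 Real.pi_pos
    positivity
  refine ((memLp_pow_mul_exp_mul_gauss hβ n 0).const_mul
    (Real.sqrt (β / Real.sqrt Real.pi))⁻¹).of_le ?_ (Filter.Eventually.of_forall fun y => ?_)
  · unfold gaussPoly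
    simp only [Polynomial.eval_pow, Polynomial.eval_X]
    exact Continuous.aestronglyMeasurable (by fun_prop)
  · have hg := gauss_nonneg β y
    rw [Real.norm_of_nonneg (by positivity), gaussPoly, Polynomial.eval_pow, Polynomial.eval_X,
      norm_mul, norm_pow, Complex.norm_real, Complex.norm_real, Real.norm_eq_abs y,
      Real.norm_of_nonneg (Real.exp_pos _).le, gauss, zero_mul, Real.exp_zero, mul_one]
    apply le_of_eq
    field_simp

lemma integral_pow_mul_gauss_mul_eq_zero {β : ℝ} (hβ : 0 < β) {N : ℕ} {f : L2R}
    (hf : f ∈ (scaledHermiteSpace N β)ᗮ) {n : ℕ} (hn : n ≤ N) :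
    ∫ y : ℝ, (y : ℂ) ^ n * (gauss β y : ℂ) * f y = 0 := by
  have hm := memLp_gaussPoly_X_pow hβ n
  have h0 : inner ℂ (hm.toLp _ : L2R) f = 0 := by
    refine (Submodule.mem_orthogonal _ _).1 hf _ ⟨Polynomial.X ^ n, ?_, hm.coeFn_toLp⟩
    rw [Polynomial.degree_X_pow]
    exact_mod_cast hn
  rw [L2.inner_def] at h0
  rw [← mul_zero (Real.sqrt (β / Real.sqrt Real.pi) : ℂ), ← h0, ← integral_const_mul]
  apply integral_congr_ae
  filter_upwards [hm.coeFn_toLp] with y hy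
  rw [hy, RCLike.inner_apply, gaussPoly, Polynomial.eval_pow, Polynomial.eval_X, map_mul,
    Complex.conj_ofReal, map_pow, Complex.conj_ofReal, gauss, Complex.ofReal_mul]
  ring

/-- Orthogonality to the Hermite space makes the Gaussian Laplace transform vanish at the origin
to order `N + 1`. -/
lemma gaussLaplace_isBigO {β : ℝ} (hβ : 0 < β) {N : ℕ} {f : L2R}
    (hf : f ∈ (scaledHermiteSpace N β)ᗮ) {z : ℂ} (hz : ‖z‖ ≤ 1) :
    ‖gaussLaplace β f z‖ ≤
      ‖z‖ ^ (N + 1) * ∫ y : ℝ, |y| ^ (N + 1) * Real.exp (1 * |y|) * gauss β y * ‖f y‖ := by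
  have hmono : ∀ n : ℕ, Integrable (fun y : ℝ => (y : ℂ) ^ n * (gauss β y : ℂ) * f y) := by
    intro n
    refine (integrable_pow_mul_exp_mul_gauss_mul hβ f n 0).mono'
      ((Continuous.aestronglyMeasurable (by fun_prop)).mul (Lp.aestronglyMeasurable f))
      (Filter.Eventually.of_forall fun y => ?_)
    rw [norm_mul, norm_mul, norm_pow, Complex.norm_real, Complex.norm_real,
      Real.norm_of_nonneg (gauss_nonneg _ _), Real.norm_eq_abs]
    simp
  have hterm : ∀ n : ℕ, ∀ y : ℝ, (z * y) ^ n / (n.factorial : ℂ) * (gauss β y : ℂ) * f y =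
      z ^ n / (n.factorial : ℂ) * ((y : ℂ) ^ n * (gauss β y : ℂ) * f y) := by
    intro n y; ring
  -- The Taylor polynomial of degree `N` of the exponential is annihilated by orthogonality, so only
  -- the Taylor remainder contributes.
  have hsum : ∫ y : ℝ, (∑ n ∈ Finset.range (N + 1), (z * y) ^ n / (n.factorial : ℂ)) *
      (gauss β y : ℂ) * f y = 0 := by
    simp_rw [Finset.sum_mul, hterm]
    rw [integral_finsetSum _ fun n _ => (hmono n).const_mul _]
    refine Finset.sum_eq_zero fun n hn => ?_
    rw [integral_const_mul, integral_pow_mul_gauss_mul_eq_zero hβ hf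
      (Nat.lt_succ_iff.1 (Finset.mem_range.1 hn)), mul_zero]
  have hisum : Integrable fun y : ℝ => (∑ n ∈ Finset.range (N + 1),
      (z * y) ^ n / (n.factorial : ℂ)) * (gauss β y : ℂ) * f y := by
    simp_rw [Finset.sum_mul, hterm]
    exact integrable_finsetSum _ fun n _ => (hmono n).const_mul _
  have hexp : Integrable fun y : ℝ => Complex.exp (z * y) * (gauss β y : ℂ) * f y :=
    (memLp_cexp_mul_gauss hβ z).integrable_mul (Lp.memLp f)
  rw [← sub_zero (gaussLaplace β f z), ← hsum, gaussLaplace, ← integral_sub hexp hisum,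
    ← integral_const_mul]
  refine norm_integral_le_of_norm_le
    ((integrable_pow_mul_exp_mul_gauss_mul hβ f (N + 1) 1).const_mul _)
    (Filter.Eventually.of_forall fun y => ?_)
  have hg := gauss_nonneg β y
  rw [← sub_mul, ← sub_mul, norm_mul, norm_mul, Complex.norm_real, Real.norm_of_nonneg hg]
  have h := Complex.norm_exp_sub_sum_le_norm_mul_exp (z * y) (N + 1)
  rw [norm_mul, Complex.norm_real, Real.norm_eq_abs, mul_pow] at h
  calc _ ≤ ‖z‖ ^ (N + 1) * |y| ^ (N + 1) * Real.exp (‖z‖ * |y|) * gauss β y * ‖f y‖ := by gcongr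
    _ ≤ ‖z‖ ^ (N + 1) * |y| ^ (N + 1) * Real.exp (1 * |y|) * gauss β y * ‖f y‖ := by gcongr
    _ = _ := by ring

lemma gabor_eq_gaussLaplace (β : ℝ) (f : L2R) (x ξ : ℝ) :
    gabor β f x ξ = Complex.exp (-(β ^ 2 * x ^ 2 / 2)) *
      gaussLaplace β f (β ^ 2 * x - 2 * Real.pi * ξ * Complex.I) := by
  rw [gabor, gaussLaplace, ← integral_const_mul]
  congr 1
  funext y
  rw [ofReal_gauss, ofReal_gauss]
  have h : Complex.exp (↑(-2 * Real.pi * y * ξ) * Complex.I) *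
      Complex.exp (-(β ^ 2 * ((y - x : ℝ) : ℂ) ^ 2) / 2) =
      Complex.exp (-(β ^ 2 * x ^ 2 / 2)) *
      (Complex.exp ((β ^ 2 * x - 2 * Real.pi * ξ * Complex.I) * y) *
        Complex.exp (-(β ^ 2 * y ^ 2) / 2)) := by
    rw [← Complex.exp_add, ← Complex.exp_add, ← Complex.exp_add]
    congr 1
    push_cast; ring
  linear_combination (Real.sqrt (β / Real.sqrt Real.pi) : ℂ) * f y * h

/-- Functions orthogonal to the Hermite space have small Gabor transform near the origin of the
phase plane. -/
lemma norm_gabor_le_of_mem_orthogonal {β : ℝ} (hβ : 0 < β) {N : ℕ} {f : L2R}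
    (hf : f ∈ (scaledHermiteSpace N β)ᗮ) {x ξ s r : ℝ} (hs : 0 ≤ s) (hsr : s < r)
    (hxξ : β ^ 2 * x ^ 2 + (2 * Real.pi / β) ^ 2 * ξ ^ 2 = 4 * s ^ 2) :
    ‖gabor β f x ξ‖ ≤ Real.exp (r ^ 2 - s ^ 2) * ‖f‖ * (s / r) ^ (N + 1) := by
  have hβ0 : (β : ℂ) ≠ 0 := by exact_mod_cast hβ.ne'
  -- The factor `e^{-t²}` makes the growth bound radial: `-Re(t²) + 2(Re t)² = |t|²`.
  set F : ℂ → ℂ := fun t => Complex.exp (-t ^ 2) * gaussLaplace β f (2 * β * t) with hF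
  have hF0 : F 0 = 0 := by
    have h := gaussLaplace_isBigO hβ hf (z := 0) (by simp)
    have h' : gaussLaplace β f 0 = 0 := by simpa using h
    simp [hF, h']
  have hd : Differentiable ℂ F := by
    have := differentiable_gaussLaplace hβ f
    fun_prop
  have hbound : ∀ t : ℂ, ‖F t‖ ≤ Real.exp (‖t‖ ^ 2) * ‖f‖ := by
    intro t
    have h := norm_gaussLaplace_le hβ f (2 * β * t)
    rw [hF]
    simp only
    rw [norm_mul, Complex.norm_exp]
    refine (mul_le_mul_of_nonneg_left h (Real.exp_pos _).le).trans (le_of_eq ?_)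
    rw [← mul_assoc, ← Real.exp_add]
    congr 2
    rw [← Complex.normSq_eq_norm_sq, Complex.normSq_apply]
    simp only [Complex.mul_re, Complex.neg_re, pow_two, Complex.ofReal_re, Complex.ofReal_im,
      Complex.re_ofNat, Complex.im_ofNat, Complex.mul_im]
    field_simp
    ring
  have hO : F =O[nhds 0] fun t => t ^ (N + 1) := by
    have h1 : (gaussLaplace β f) =O[nhds 0] fun z : ℂ => z ^ (N + 1) := by
      refine Asymptotics.IsBigO.of_bound
        (∫ y : ℝ, |y| ^ (N + 1) * Real.exp (1 * |y|) * gauss β y * ‖f y‖) ?_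
      filter_upwards [Metric.closedBall_mem_nhds (0 : ℂ) one_pos] with z hz
      rw [norm_pow, mul_comm]
      exact gaussLaplace_isBigO hβ hf (mem_closedBall_zero_iff.1 hz)
    have h2 : (fun t : ℂ => gaussLaplace β f (2 * β * t)) =O[nhds 0] fun t => t ^ (N + 1) := by
      have ht : Filter.Tendsto (fun t : ℂ => 2 * (β : ℂ) * t) (nhds 0) (nhds 0) := by
        have : Continuous fun t : ℂ => 2 * (β : ℂ) * t := by fun_prop
        simpa using this.tendsto 0
      refine (h1.comp_tendsto ht).trans ?_
      simp only [Function.comp_def, mul_pow _ _ (N + 1)]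
      exact Asymptotics.isBigO_const_mul_self _ _ _
    have h3 : (fun t : ℂ => Complex.exp (-t ^ 2)) =O[nhds 0] fun _ => (1 : ℂ) :=
      (Continuous.tendsto (by fun_prop) 0).isBigO_one ℂ
    simpa using! h3.mul h2
  -- The Schwarz lemma needs `o(|t|^N)` to yield the exponent `N + 1`.
  have ho : (fun t => F t - F 0) =o[nhds 0] fun t : ℂ => ‖t - 0‖ ^ N := by
    simp only [hF0, sub_zero]
    refine hO.trans_isLittleO ?_
    rw [← Asymptotics.isLittleO_norm_left]
    simp_rw [norm_pow]
    refine (Asymptotics.isLittleO_pow_pow (𝕜 := ℝ) N.lt_succ_self).comp_tendsto ?_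
    simpa using! (continuous_norm (E := ℂ)).tendsto 0
  -- Chosen so that `2βt = β²x - 2πiξ`, the Laplace variable of the phase point `(x, ξ)`; then `|t|
  -- = s`.
  set t : ℂ := (β * x - 2 * Real.pi / β * ξ * Complex.I) / 2 with ht
  have htn : ‖t‖ ^ 2 = s ^ 2 := by
    have : t = ((β * x / 2 : ℝ) : ℂ) + ((-(2 * Real.pi / β * ξ / 2) : ℝ) : ℂ) * Complex.I := by
      rw [ht]; push_cast; ring
    rw [← Complex.normSq_eq_norm_sq, this, Complex.normSq_add_mul_I]
    linear_combination hxξ / 4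
  have hts : ‖t‖ = s := by
    rwa [sq_eq_sq₀ (norm_nonneg _) hs] at htn
  have hSchwarz : dist (F t) (F 0) ≤ Real.exp (r ^ 2) * ‖f‖ * (dist t 0 / r) ^ (N + 1) := by
    refine Complex.dist_le_mul_div_pow_of_mapsTo_ball_of_isLittleO hd.differentiableOn ?_ ho ?_
    · intro w hw
      rw [hF0, mem_closedBall_zero_iff]
      refine (hbound w).trans ?_
      have := (mem_ball_zero_iff.1 hw).le
      gcongr
    · rwa [mem_ball_zero_iff, hts]
  rw [hF0, dist_zero_right, dist_zero_right, hts] at hSchwarz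
  have hV : gabor β f x ξ = Complex.exp (t ^ 2 - β ^ 2 * x ^ 2 / 2) * F t := by
    rw [gabor_eq_gaussLaplace β, hF]
    simp only
    rw [← mul_assoc, ← Complex.exp_add]
    congr 2
    · ring
    · rw [ht]; field_simp
  have hre : (t ^ 2 - β ^ 2 * x ^ 2 / 2 : ℂ).re = -s ^ 2 := by
    have : t ^ 2 - β ^ 2 * x ^ 2 / 2 = ((-s ^ 2 : ℝ) : ℂ) +
        ((-(β * x * (2 * Real.pi / β * ξ) / 2) : ℝ) : ℂ) * Complex.I := by
      have h' : (β : ℂ) ^ 2 * x ^ 2 + (2 * Real.pi / β) ^ 2 * ξ ^ 2 = 4 * s ^ 2 := by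
        exact_mod_cast hxξ
      rw [ht]
      push_cast
      linear_combination (-1 / 4 : ℂ) * h' + (2 * Real.pi / β * ξ / 2 : ℂ) ^ 2 * Complex.I_sq
    rw [this, Complex.add_re, Complex.ofReal_re, Complex.re_ofReal_mul, Complex.I_re, mul_zero,
      add_zero]
  rw [hV, norm_mul, Complex.norm_exp, hre]
  refine (mul_le_mul_of_nonneg_left hSchwarz (Real.exp_pos _).le).trans (le_of_eq ?_)
  rw [sub_eq_neg_add, Real.exp_add]
  ring

/-! ### Tails and the change of frequency unit `k = 2πξ` -/

lemma measurableSet_lt_abs (r : ℝ) : MeasurableSet {x : ℝ | r < |x|} :=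
  measurableSet_lt measurable_const measurable_norm

lemma enorm_tail_sq (r : ℝ) (f : L2R) :
    ‖tail r f‖ₑ ^ 2 = ∫⁻ y in {y : ℝ | r < |y|}, ‖f y‖ₑ ^ 2 := by
  rw [tail, Lp.enorm_toLp, eLpNorm_indicator_eq_eLpNorm_restrict (measurableSet_lt_abs r),
    eLpNorm_two_sq]

lemma enorm_tail_fourierL2_sq (r : ℝ) (u : L2R) :
    ‖tail r (fourierL2 u)‖ₑ ^ 2 =
      ∫⁻ ξ in {ξ : ℝ | r / (2 * Real.pi) < |ξ|}, ‖(𝓕 u : L2R) ξ‖ₑ ^ 2 := by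
  have hπ : 0 < 2 * Real.pi := by positivity
  have hm := (Lp.stronglyMeasurable (𝓕 u : L2R)).measurable
  have hS := measurableSet_lt_abs (r / (2 * Real.pi))
  set h : ℝ → ENNReal :=
    {ξ : ℝ | r / (2 * Real.pi) < |ξ|}.indicator (fun ξ => ‖(𝓕 u : L2R) ξ‖ₑ ^ 2) with hh
  have hmeas : Measurable h := Measurable.indicator (by fun_prop) hS
  have hmap := lintegral_map (μ := volume) hmeas (measurable_const_mul (2 * Real.pi)⁻¹)
  rw [Real.map_volume_mul_left (by positivity), lintegral_smul_measure, inv_inv,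
    abs_of_pos hπ] at hmap
  rw [enorm_tail_sq, ← lintegral_indicator hS, ← lintegral_indicator (measurableSet_lt_abs r)]
  calc ∫⁻ k, {y : ℝ | r < |y|}.indicator (fun y => ‖fourierL2 u y‖ₑ ^ 2) k
      = ∫⁻ k, ENNReal.ofReal (2 * Real.pi)⁻¹ * h ((2 * Real.pi)⁻¹ * k) := by
        apply lintegral_congr_ae
        filter_upwards [(memLp_fourier_scaled u).coeFn_toLp] with k hk
        have hiff : r / (2 * Real.pi) < |(2 * Real.pi)⁻¹ * k| ↔ r < |k| := by
          rw [abs_mul, abs_of_pos (inv_pos.2 hπ), div_eq_inv_mul,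
            mul_lt_mul_iff_right₀ (inv_pos.2 hπ)]
        by_cases hr : r < |k|
        · rw [hh, Set.indicator_of_mem (by exact hr), Set.indicator_of_mem (by exact hiff.2 hr),
            fourierL2, hk, enorm_mul, mul_pow]
          congr 1
          rw [← ofReal_norm, norm_inv, Complex.norm_real, Real.norm_of_nonneg (by positivity),
            ← ENNReal.ofReal_pow (by positivity), inv_pow, Real.sq_sqrt hπ.le]
        · rw [hh, Set.indicator_of_notMem (by exact hr),
            Set.indicator_of_notMem (by exact fun h' => hr (hiff.1 h')), mul_zero]
    _ = ∫⁻ ξ, h ξ := by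
        rw [lintegral_const_mul _ (by fun_prop), ← hmap, smul_eq_mul, ← mul_assoc,
          ← ENNReal.ofReal_mul (by positivity), inv_mul_cancel₀ hπ.ne', ENNReal.ofReal_one, one_mul]

lemma lintegral_enorm_mul_le {α : Type*} [MeasurableSpace α] {μ : Measure α} {a b : α → ℂ}
    (ha : AEStronglyMeasurable a μ) (hb : AEStronglyMeasurable b μ) :
    ∫⁻ x, ‖a x‖ₑ * ‖b x‖ₑ ∂μ ≤ eLpNorm a 2 μ * eLpNorm b 2 μ := by
  have h := eLpNorm_smul_le_mul_eLpNorm (p := 2) (q := 2) (r := 1) hb ha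
  rw [eLpNorm_one_eq_lintegral_enorm] at h
  simpa [enorm_mul] using h

/-! ### The Gabor transform inside and outside a phase-space box -/

/-- The part of the Gabor transform over positions beyond `2d`. -/
lemma setLIntegral_gabor_position_le {β d : ℝ} (hβ : 0 < β) (hd : 0 ≤ d) (u : L2R) :
    ∫⁻ p in {p : ℝ × ℝ | 2 * d < |p.1|}, ‖gabor β u p.1 p.2‖ₑ ^ 2 ≤
      ‖tail d u‖ₑ ^ 2 + 2 * ENNReal.ofReal (Real.exp (-β ^ 2 * d ^ 2)) * ‖u‖ₑ ^ 2 := by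
  have hm := (stronglyMeasurable_gabor β u).measurable
  have hS : {p : ℝ × ℝ | 2 * d < |p.1|} = {x : ℝ | 2 * d < |x|} ×ˢ Set.univ := by
    ext p; simp
  rw [hS, Measure.volume_eq_prod, ← Measure.prod_restrict, Measure.restrict_univ,
    lintegral_prod _ (by fun_prop), enorm_tail_sq]
  exact setLIntegral_gabor_tail_le hβ hd u

/-- The part of the Gabor transform over frequencies beyond `2d`. -/
lemma setLIntegral_gabor_frequency_le {β d : ℝ} (hβ : 0 < β) (hd : 0 ≤ d) (u : L2R) :
    ∫⁻ p in {p : ℝ × ℝ | 2 * d < |p.2|}, ‖gabor β u p.1 p.2‖ₑ ^ 2 ≤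
      ‖tail d (𝓕 u : L2R)‖ₑ ^ 2 +
        2 * ENNReal.ofReal (Real.exp (-(2 * Real.pi / β) ^ 2 * d ^ 2)) * ‖u‖ₑ ^ 2 := by
  have hm := (stronglyMeasurable_gabor β u).measurable
  have hS : {p : ℝ × ℝ | 2 * d < |p.2|} = Set.univ ×ˢ {x : ℝ | 2 * d < |x|} := by
    ext p; simp
  rw [hS, Measure.volume_eq_prod, ← Measure.prod_restrict, Measure.restrict_univ,
    lintegral_prod_symm _ (by fun_prop), enorm_tail_sq]
  have hnorm : ‖u‖ₑ = ‖(𝓕 u : L2R)‖ₑ := by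
    rw [← ofReal_norm, ← ofReal_norm, Lp.norm_fourier_eq]
  rw [hnorm]
  refine le_trans (le_of_eq ?_)
    (setLIntegral_gabor_tail_le (by positivity : 0 < 2 * Real.pi / β) hd (𝓕 u : L2R))
  refine lintegral_congr fun ξ => ?_
  simp_rw [enorm_gabor_fourier hβ u]
  exact lintegral_neg_eq_self fun x => ‖gabor (2 * Real.pi / β) (𝓕 u) ξ x‖ₑ ^ 2

/-- On `[0, 1/2]` the function `q e^{1-q}` is largest at `1/2`, with value `e^{1/2 - log 2}`. As
`log 2 > 27/40`, this is below `e^{-7/40}`. -/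
lemma mul_exp_one_sub_pow_le {q : ℝ} (hq : 0 ≤ q) (hq2 : q ≤ 1 / 2) (N : ℕ) :
    Real.exp (N * (1 - q)) * q ^ (N + 1) ≤ Real.exp (-(7 / 40 * N)) := by
  have h1 : Real.exp (1 - q) * q ≤ Real.exp (-(7 / 40)) := by
    have h2 : 2 * q ≤ Real.exp (q - 1 / 2) := by
      have := Real.add_one_le_exp (q - 1 / 2)
      linarith
    have h3 : (1 / 2 : ℝ) ≤ Real.exp (-(27 / 40)) := by
      have := Real.log_two_gt_d9
      rw [one_div, ← Real.exp_log (two_pos : (0 : ℝ) < 2), ← Real.exp_neg]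
      exact Real.exp_le_exp.2 (by linarith)
    calc Real.exp (1 - q) * q ≤ Real.exp (1 - q) * (Real.exp (q - 1 / 2) * Real.exp (-(27 / 40))) := by
          gcongr
          nlinarith [Real.exp_pos (q - 1 / 2)]
      _ = Real.exp (-(7 / 40)) := by
          rw [← Real.exp_add, ← Real.exp_add]; congr 1; ring
  calc Real.exp (N * (1 - q)) * q ^ (N + 1) ≤ Real.exp (N * (1 - q)) * q ^ N := by
        gcongr _ * ?_
        exact pow_le_pow_of_le_one hq (by linarith) N.le_succ
    _ = (Real.exp (1 - q) * q) ^ N := by rw [mul_pow, ← Real.exp_nat_mul]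
    _ ≤ Real.exp (-(7 / 40)) ^ N := by gcongr
    _ = Real.exp (-(7 / 40 * N)) := by rw [← Real.exp_nat_mul]; congr 1; ring

/-- The factor `N` from the box area is absorbed by giving up `1/20` of the rate: `7/40 - 1/20 = 1/8
= 2 · 1/16`. -/
lemma nat_mul_exp_le (N : ℕ) :
    N * Real.exp (-(7 / 40 * N)) ≤ (5 * Real.exp (-(1 / 16 * (N : ℝ)))) ^ 2 := by
  have h : (N : ℝ) ≤ 25 * Real.exp (N / 20) := by
    have := Real.add_one_le_exp ((N : ℝ) / 20)
    have hN : (0 : ℝ) ≤ N := N.cast_nonneg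
    linarith
  calc N * Real.exp (-(7 / 40 * N)) ≤ 25 * Real.exp (N / 20) * Real.exp (-(7 / 40 * N)) := by gcongr
    _ = (5 * Real.exp (-(1 / 16 * (N : ℝ)))) ^ 2 := by
        rw [mul_assoc, ← Real.exp_add, mul_pow, ← Real.exp_nat_mul]
        norm_num
        ring

/-- Pointwise bound on the box `|x| ≤ 2d`, `|ξ| ≤ 2d'` in phase space. -/
lemma norm_gabor_sq_le_of_mem_box {β : ℝ} (hβ : 0 < β) {N : ℕ} (hN : 0 < N) {f : L2R}
    (hf : f ∈ (scaledHermiteSpace N β)ᗮ) {x ξ d d' : ℝ} (hd : β ^ 2 * d ^ 2 = N / 8)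
    (hd' : (2 * Real.pi / β) ^ 2 * d' ^ 2 = N / 8) (hx : |x| ≤ 2 * d) (hξ : |ξ| ≤ 2 * d') :
    ‖gabor β f x ξ‖ ^ 2 ≤ Real.exp (-(7 / 40 * N)) * ‖f‖ ^ 2 := by
  have hN' : (0 : ℝ) < N := by exact_mod_cast hN
  set S : ℝ := (β ^ 2 * x ^ 2 + (2 * Real.pi / β) ^ 2 * ξ ^ 2) / 4 with hS
  have hS0 : 0 ≤ S := by positivity
  have hx2 : x ^ 2 ≤ (2 * d) ^ 2 := by rw [← sq_abs]; gcongr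
  have hξ2 : ξ ^ 2 ≤ (2 * d') ^ 2 := by rw [← sq_abs]; gcongr
  have hSle : S ≤ N / 4 := by
    have h1 := mul_le_mul_of_nonneg_left hx2 (sq_nonneg β)
    have h2 := mul_le_mul_of_nonneg_left hξ2 (sq_nonneg (2 * Real.pi / β))
    rw [hS]; linarith
  have hs2 : Real.sqrt S ^ 2 = S := Real.sq_sqrt hS0
  -- The box lies in `s² ≤ N/4`. The Schwarz disc has `r² = N/2`, so the ratio `q = s²/r²` is at
  -- most `1/2`.
  have hr2 : Real.sqrt (N / 2) ^ 2 = (N / 2 : ℝ) := Real.sq_sqrt (by positivity)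
  have h := norm_gabor_le_of_mem_orthogonal hβ hf (x := x) (ξ := ξ) (Real.sqrt_nonneg S)
    (Real.sqrt_lt_sqrt hS0 (by linarith : S < N / 2)) (by rw [hs2, hS]; ring)
  rw [hs2, hr2] at h
  have hq := mul_exp_one_sub_pow_le (q := S / (N / 2)) (by positivity)
    (by rw [div_le_iff₀ (by positivity)]; linarith) N
  calc ‖gabor β f x ξ‖ ^ 2
      ≤ (Real.exp (N / 2 - S) * ‖f‖ * (Real.sqrt S / Real.sqrt (N / 2)) ^ (N + 1)) ^ 2 := by gcongr
    _ = Real.exp (N * (1 - S / (N / 2))) * (S / (N / 2)) ^ (N + 1) * ‖f‖ ^ 2 := by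
        rw [mul_pow, mul_pow, ← Real.exp_nat_mul, ← pow_mul, mul_comm (N + 1) 2, pow_mul, div_pow,
          hs2, hr2, show ((2 : ℕ) : ℝ) * (N / 2 - S) = N * (1 - S / (N / 2)) by
            push_cast; field_simp]
        ring
    _ ≤ Real.exp (-(7 / 40 * N)) * ‖f‖ ^ 2 := by gcongr

lemma eLpNorm_gabor_box_le {β : ℝ} (hβ : 0 < β) {N : ℕ} (hN : 0 < N) {f : L2R}
    (hf : f ∈ (scaledHermiteSpace N β)ᗮ) {d d' : ℝ} (hd0 : 0 ≤ d) (hd0' : 0 ≤ d')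
    (hd : β ^ 2 * d ^ 2 = N / 8) (hd' : (2 * Real.pi / β) ^ 2 * d' ^ 2 = N / 8) :
    eLpNorm (fun p : ℝ × ℝ => gabor β f p.1 p.2) 2
        (volume.restrict (Set.Icc (-(2 * d)) (2 * d) ×ˢ Set.Icc (-(2 * d')) (2 * d'))) ≤
      ENNReal.ofReal (5 * Real.exp (-(1 / 16 * (N : ℝ))) * ‖f‖) := by
  rw [← ENNReal.pow_le_pow_left_iff two_ne_zero, eLpNorm_two_sq,
    ← ENNReal.ofReal_pow (by positivity)]
  -- The area is `16 d d' = N/π`, independent of `β`.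
  have harea : (2 * d - -(2 * d)) * (2 * d' - -(2 * d')) ≤ N := by
    have h1 : (2 * Real.pi * (d * d')) ^ 2 = ((N : ℝ) / 8) ^ 2 := by
      have : (2 * Real.pi * (d * d')) ^ 2 =
          (β ^ 2 * d ^ 2) * ((2 * Real.pi / β) ^ 2 * d' ^ 2) := by field_simp
      rw [this, hd, hd']; ring
    have h2 : 2 * Real.pi * (d * d') = N / 8 := by
      rwa [sq_eq_sq₀ (by positivity) (by positivity)] at h1
    nlinarith [Real.pi_gt_three, mul_nonneg hd0 hd0']
  calc ∫⁻ p in Set.Icc (-(2 * d)) (2 * d) ×ˢ Set.Icc (-(2 * d')) (2 * d'), ‖gabor β f p.1 p.2‖ₑ ^ 2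
      ≤ ∫⁻ p in Set.Icc (-(2 * d)) (2 * d) ×ˢ Set.Icc (-(2 * d')) (2 * d'),
          ENNReal.ofReal (Real.exp (-(7 / 40 * N)) * ‖f‖ ^ 2) := by
        refine setLIntegral_mono' (measurableSet_Icc.prod measurableSet_Icc) fun p hp => ?_
        rw [← ofReal_norm, ← ENNReal.ofReal_pow (norm_nonneg _)]
        exact ENNReal.ofReal_le_ofReal (norm_gabor_sq_le_of_mem_box hβ hN hf hd hd'
          (abs_le.2 hp.1) (abs_le.2 hp.2))
    _ = ENNReal.ofReal (Real.exp (-(7 / 40 * N)) * ‖f‖ ^ 2 *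
          ((2 * d - -(2 * d)) * (2 * d' - -(2 * d')))) := by
        rw [setLIntegral_const, Measure.volume_eq_prod, Measure.prod_prod, Real.volume_Icc,
          Real.volume_Icc, ← ENNReal.ofReal_mul (by linarith), ← ENNReal.ofReal_mul (by positivity)]
    _ ≤ ENNReal.ofReal ((5 * Real.exp (-(1 / 16 * (N : ℝ))) * ‖f‖) ^ 2) := by
        apply ENNReal.ofReal_le_ofReal
        have := mul_le_mul_of_nonneg_left (nat_mul_exp_le N) (sq_nonneg ‖f‖)
        have h2 := mul_le_mul_of_nonneg_left harea
          (by positivity : 0 ≤ Real.exp (-(7 / 40 * N)) * ‖f‖ ^ 2)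
        nlinarith

lemma eLpNorm_gabor_compl_box_le {β : ℝ} (hβ : 0 < β) {N : ℕ} (u : L2R) {d d' : ℝ} (hd0 : 0 ≤ d)
    (hd0' : 0 ≤ d') (hd : β ^ 2 * d ^ 2 = N / 8) (hd' : (2 * Real.pi / β) ^ 2 * d' ^ 2 = N / 8) :
    eLpNorm (fun p : ℝ × ℝ => gabor β u p.1 p.2) 2
        (volume.restrict (Set.Icc (-(2 * d)) (2 * d) ×ˢ Set.Icc (-(2 * d')) (2 * d'))ᶜ) ≤
      ENNReal.ofReal (‖tail d u‖ + ‖tail d' (𝓕 u : L2R)‖ +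
        2 * Real.exp (-(1 / 16 * (N : ℝ))) * ‖u‖) := by
  have hsub : (Set.Icc (-(2 * d)) (2 * d) ×ˢ Set.Icc (-(2 * d')) (2 * d'))ᶜ ⊆
      {p : ℝ × ℝ | 2 * d < |p.1|} ∪ {p : ℝ × ℝ | 2 * d' < |p.2|} := by
    intro p hp
    by_contra h
    simp only [Set.mem_union, Set.mem_ofPred_eq, not_or, not_lt] at h
    exact hp ⟨abs_le.1 h.1, abs_le.1 h.2⟩
  have h1 := setLIntegral_gabor_position_le hβ hd0 u
  have h2 := setLIntegral_gabor_frequency_le hβ hd0' u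
  rw [neg_mul, hd] at h1
  rw [neg_mul, hd'] at h2
  have hexp : Real.exp (-((N : ℝ) / 8)) = Real.exp (-(1 / 16 * (N : ℝ))) ^ 2 := by
    rw [← Real.exp_nat_mul]; congr 1; push_cast; ring
  rw [← ENNReal.pow_le_pow_left_iff two_ne_zero, eLpNorm_two_sq]
  refine (lintegral_mono_set hsub).trans ((lintegral_union_le _ _ _).trans
    ((add_le_add h1 h2).trans ?_))
  simp_rw [← ofReal_norm]
  have hE := (Real.exp_pos (-((N : ℝ) / 8))).le
  have htwo : 2 * ENNReal.ofReal (Real.exp (-((N : ℝ) / 8))) =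
      ENNReal.ofReal (2 * Real.exp (-((N : ℝ) / 8))) := by
    rw [ENNReal.ofReal_mul two_pos.le, ENNReal.ofReal_ofNat]
  rw [htwo]
  simp_rw [← ENNReal.ofReal_pow (norm_nonneg _)]
  rw [← ENNReal.ofReal_mul (by positivity),
    ← ENNReal.ofReal_add (by positivity) (by positivity),
    ← ENNReal.ofReal_add (by positivity) (by positivity),
    ← ENNReal.ofReal_add (by positivity) (by positivity), ← ENNReal.ofReal_pow (by positivity)]
  apply ENNReal.ofReal_le_ofReal
  rw [hexp]
  have hE' := (Real.exp_pos (-(1 / 16 * (N : ℝ)))).le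
  generalize Real.exp (-(1 / 16 * (N : ℝ))) = E at *
  have ha := norm_nonneg (tail d u)
  have hb := norm_nonneg (tail d' (𝓕 u : L2R))
  have hc := mul_nonneg hE' (norm_nonneg u)
  -- The two Gaussian errors add up to `(2E‖u‖)²`, and a sum of squares of nonnegative numbers is at
  -- most the square of the sum.
  nlinarith [mul_nonneg ha hb, mul_nonneg ha hc, mul_nonneg hb hc]

lemma norm_tail_fourierL2 (r : ℝ) (u : L2R) :
    ‖tail r (fourierL2 u)‖ = ‖tail (r / (2 * Real.pi)) (𝓕 u : L2R)‖ := by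
  have h : ‖tail r (fourierL2 u)‖ₑ = ‖tail (r / (2 * Real.pi)) (𝓕 u : L2R)‖ₑ :=
    (ENNReal.pow_right_strictMono two_ne_zero).injective
      ((enorm_tail_fourierL2_sq r u).trans (enorm_tail_sq _ _).symm)
  rw [← toReal_enorm, h, toReal_enorm]

/-! ### Duality and conclusion -/

/-- Splitting the phase plane into a set `A` and its complement. -/
lemma enorm_inner_le_gabor {β : ℝ} (hβ : 0 < β) (f u : L2R) {A : Set (ℝ × ℝ)}
    (hA : MeasurableSet A) :
    ‖inner ℂ f u‖ₑ ≤
      eLpNorm (fun p : ℝ × ℝ => gabor β f p.1 p.2) 2 (volume.restrict A) * ‖u‖ₑ +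
      ‖f‖ₑ * eLpNorm (fun p : ℝ × ℝ => gabor β u p.1 p.2) 2 (volume.restrict Aᶜ) := by
  have hmf := fun μ : Measure (ℝ × ℝ) => (stronglyMeasurable_gabor β f).aestronglyMeasurable (μ := μ)
  have hmu := fun μ : Measure (ℝ × ℝ) => (stronglyMeasurable_gabor β u).aestronglyMeasurable (μ := μ)
  rw [← integral_gabor_inner hβ f u]
  refine (enorm_integral_le_lintegral_enorm _).trans ?_
  have hpt : ∀ p : ℝ × ℝ, ‖inner ℂ (gabor β f p.1 p.2) (gabor β u p.1 p.2)‖ₑ =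
      ‖gabor β f p.1 p.2‖ₑ * ‖gabor β u p.1 p.2‖ₑ := fun p => by
    rw [RCLike.inner_apply, enorm_mul, RCLike.enorm_conj, mul_comm]
  simp_rw [hpt]
  rw [← lintegral_add_compl _ hA, ← eLpNorm_gabor hβ u, ← eLpNorm_gabor hβ f]
  gcongr
  · refine (lintegral_enorm_mul_le (hmf _) (hmu _)).trans ?_
    gcongr
    exact Measure.restrict_le_self
  · refine (lintegral_enorm_mul_le (hmf _) (hmu _)).trans ?_
    gcongr
    exact Measure.restrict_le_self

lemma norm_sub_hermiteProj_sq (N : ℕ) (β : ℝ) (u : L2R) :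
    ‖u - hermiteProj N β u‖ ^ 2 = ‖inner ℂ (u - hermiteProj N β u) u‖ := by
  have h : inner ℂ (u - hermiteProj N β u) (hermiteProj N β u) = 0 :=
    Submodule.starProjection_inner_eq_zero u _ (Submodule.starProjection_apply_mem _ u)
  have h2 : inner ℂ (u - hermiteProj N β u) u =
      inner ℂ (u - hermiteProj N β u) (u - hermiteProj N β u) := by
    conv_rhs => rw [inner_sub_right, h, sub_zero]
  rw [h2, inner_self_eq_norm_sq_to_K, norm_pow, RCLike.norm_ofReal, abs_norm]

theorem norm_sub_hermiteProj_le {N : ℕ} (hN : 0 < N) {β : ℝ} (hβ : 0 < β) (u : L2R) {d d' : ℝ}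
    (hd0 : 0 ≤ d) (hd0' : 0 ≤ d') (hd : β ^ 2 * d ^ 2 = N / 8)
    (hd' : (2 * Real.pi / β) ^ 2 * d' ^ 2 = N / 8) :
    ‖u - hermiteProj N β u‖ ≤ ‖tail d u‖ + ‖tail d' (𝓕 u : L2R)‖ +
      7 * Real.exp (-(1 / 16 * (N : ℝ))) * ‖u‖ := by
  have hsq := norm_sub_hermiteProj_sq N β u
  have hf : u - hermiteProj N β u ∈ (scaledHermiteSpace N β)ᗮ :=
    Submodule.sub_starProjection_mem_orthogonal u
  generalize u - hermiteProj N β u = f at *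
  have h := (enorm_inner_le_gabor hβ f u
    (measurableSet_Icc.prod measurableSet_Icc)).trans
    (add_le_add (mul_le_mul_left (eLpNorm_gabor_box_le hβ hN hf hd0 hd0' hd hd') _)
      (mul_le_mul_right (eLpNorm_gabor_compl_box_le hβ u hd0 hd0' hd hd') _))
  simp_rw [← ofReal_norm] at h
  rw [← ENNReal.ofReal_mul (by positivity), ← ENNReal.ofReal_mul (by positivity),
    ← ENNReal.ofReal_add (by positivity) (by positivity),
    ENNReal.ofReal_le_ofReal_iff (by positivity), ← hsq] at h
  rcases (norm_nonneg f).eq_or_lt with h0 | h0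
  · rw [← h0]; positivity
  · refine le_of_mul_le_mul_left ?_ h0
    linarith

end HermiteProjection

end

open HermiteProjection in
theorem theorem2p4 :
    ∃ C : ℝ, 0 < C ∧ ∀ (N : ℕ) (β : ℝ), 0 < β → ∀ u : HermiteProjection.L2R,
      ‖u - HermiteProjection.hermiteProj N β u‖ ≤
        C * (‖HermiteProjection.tail (1 / (2 * Real.sqrt 2) * Real.sqrt N / β) u‖
          + ‖HermiteProjection.tail (1 / (2 * Real.sqrt 2) * Real.sqrt N * β)
              (HermiteProjection.fourierL2 u)‖
          + ‖u‖ * Real.exp (-(1 / 16 * (N : ℝ)))) := by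
  -- `7 = 5 + 2`, from the inside and the outside of the box. For `N = 0` the Schwarz disc
  -- degenerates, but the exponential is `1` and the error is at most `‖u‖`.
  refine ⟨7, by norm_num, fun N β hβ u => ?_⟩
  rcases N.eq_zero_or_pos with rfl | hN
  · have hle : ‖u - hermiteProj 0 β u‖ ≤ ‖u‖ := by
      have h := (norm_sub_hermiteProj_sq 0 β u).le.trans (norm_inner_le_norm _ _)
      rw [pow_two] at h
      rcases (norm_nonneg (u - hermiteProj 0 β u)).eq_or_lt with h0 | h0
      · rw [← h0]; positivity
      · exact le_of_mul_le_mul_left h h0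
    have h1 := norm_nonneg (tail (1 / (2 * Real.sqrt 2) * Real.sqrt (0 : ℕ) / β) u)
    have h2 := norm_nonneg (tail (1 / (2 * Real.sqrt 2) * Real.sqrt (0 : ℕ) * β) (fourierL2 u))
    have h3 := norm_nonneg u
    rw [Nat.cast_zero] at *
    rw [mul_zero, neg_zero, Real.exp_zero, mul_one]
    linarith
  · have h2 : Real.sqrt 2 ^ 2 = 2 := Real.sq_sqrt two_pos.le
    have hNs : Real.sqrt N ^ 2 = N := Real.sq_sqrt N.cast_nonneg
    have hsq : (1 / (2 * Real.sqrt 2) * Real.sqrt N) ^ 2 = (N : ℝ) / 8 := by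
      rw [mul_pow, div_pow, mul_pow, h2, hNs]; ring
    have h := norm_sub_hermiteProj_le hN hβ u
      (d := 1 / (2 * Real.sqrt 2) * Real.sqrt N / β)
      (d' := 1 / (2 * Real.sqrt 2) * Real.sqrt N * β / (2 * Real.pi))
      (by positivity) (by positivity)
      (by rw [div_pow, ← hsq]; field_simp) (by rw [← hsq]; field_simp)
    rw [norm_tail_fourierL2]
    have ha := norm_nonneg (tail (1 / (2 * Real.sqrt 2) * Real.sqrt N / β) u)
    have hb := norm_nonneg
      (tail (1 / (2 * Real.sqrt 2) * Real.sqrt N * β / (2 * Real.pi)) (𝓕 u : L2R))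
    linarith
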